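/- **Theorem (gap-dependent regret upper bound).** Let $\mathcal A$ be a set of $n$ arms, let $1\le k<n$, and call the $k$-element subsets of $\mathcal A$ *sets*. Whenever a set $s$ is offered, binary rewards $X_{a,s}\in\{0,1\}$, $a\in s$, are drawn, independently of the past given $s$, from a joint law that depends only on $s$ (the rewards of one round may be dependent). Put $P(a\mid s)=\mathbb E[X_{a,s}]$ and $Q(s)=\sum_{a\in s}X_{a,s}$. Let $s^*$ be the set that maximizes $\mathbb E[Q(s)]$, assume that it is the unique maximizer, and let $$\epsilon=\min_{s\ne s^*}\bigl(\mathbb E[Q(s^*)]-\mathbb E[Q(s)]\bigr)>0 .$$ Assume weak optimal set consistency: $P(a\mid s)\ge P(a\mid s^*)$ for every suboptimal set $s$ and every arm $a\in s\cap s^*$. For a horizon $T$ and a parameter $\alpha\ge 2$, consider the top-$k$ UCB algorithm: start with $N_a=C_a=0$ and $\mathrm{UCB}_a=\infty$ for every arm $a$; in each round $t=1,\dots,T$ offer a set $s(t)$ of $k$ arms with the $k$ largest values of $\mathrm{UCB}_a$ (ties broken at random, by any rule that may depend on the past), observe $X_{a,s(t)}$ for $a\in s(t)$, and for each $a\in s(t)$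 increase $N_a$ by $1$ and $C_a$ by $X_{a,s(t)}$, and then set $\mathrm{UCB}_a=C_a/N_a+\sqrt{\alpha\log T/N_a}$; nothing changes for the other arms. Then the regret $R(T)=\sum_{t=1}^{T}\mathbb E[Q(s^*)-Q(s(t))]$ satisfies $$R(T)\le \frac{8\alpha k^{3/2}n\log T}{\epsilon}+\frac{30\alpha k^{2}n\log T}{\epsilon}+n ,$$ and for $T\ge 2$ the right-hand side is at most $K\,\alpha k^{2}n\log T/\epsilon$ with an absolute constant $K$; that is, it is $O(\alpha k^2 n\log T/\epsilon)$. -/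

import Mathlib

/-! Stochastic combinatorial bandits with binary, set-dependent rewards, and the top-`k` UCB
algorithm that keeps one index per arm. Arms are the elements of `Fin n`; a set is a `Finset` of
arms of cardinality `k`. -/

noncomputable section

/-- Expectation of a real function of an outcome with law `p` on a finite type. -/
def expect {β : Type*} [Fintype β] (p : PMF β) (f : β → ℝ) : ℝ :=
  ∑ b, (p b).toReal * f b

/-- The numerical reward (`0` or `1`) of arm `a` in the reward vector `x`. -/
def armReward {n : ℕ} (x : Fin n → Bool) (a : Fin n) : ℝ :=
  if x a then 1 else 0

/-- A reward model: `ν s` is the joint law of the binary rewards `(X_{a,s})` generated when the set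
`s` is offered. The rewards of the arms of `s` may have any dependence. Coordinates outside `s` are
never used by the algorithm or by the regret. -/
abbrev RewardModel (n : ℕ) : Type := Finset (Fin n) → PMF (Fin n → Bool)

/-- `P(a | s) = E[X_{a,s}]`. -/
def armMean {n : ℕ} (ν : RewardModel n) (a : Fin n) (s : Finset (Fin n)) : ℝ :=
  expect (ν s) (fun x => armReward x a)

/-- `E[Q(s)]`, where `Q(s) = ∑_{a ∈ s} X_{a,s}` is the total reward of the set `s`. -/
def setMean {n : ℕ} (ν : RewardModel n) (s : Finset (Fin n)) : ℝ :=
  expect (ν s) (fun x => ∑ a ∈ s, armReward x a)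

/-- `sstar` has `k` arms and maximizes the expected reward among the sets of `k` arms. -/
def IsOptimalSet {n : ℕ} (ν : RewardModel n) (k : ℕ) (sstar : Finset (Fin n)) : Prop :=
  sstar.card = k ∧ ∀ s : Finset (Fin n), s.card = k → setMean ν s ≤ setMean ν sstar

/-- Weak optimal set consistency: every arm common to a suboptimal set `s` and to `sstar` has
in `s` at least the expected reward that it has in `sstar`. -/
def WeakOptimalSetConsistency {n : ℕ} (ν : RewardModel n) (k : ℕ) (sstar : Finset (Fin n)) :
    Prop :=
  ∀ s : Finset (Fin n), s.card = k → setMean ν s < setMean ν sstar →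
    ∀ a ∈ s ∩ sstar, armMean ν a sstar ≤ armMean ν a s

/-- `ε = min_{s ≠ sstar} E[Q(sstar) - Q(s)]`, the minimum being over the sets `s` of `k` arms. -/
def IsMinGap {n : ℕ} (ν : RewardModel n) (k : ℕ) (sstar : Finset (Fin n)) (ε : ℝ) : Prop :=
  IsLeast {g : ℝ | ∃ s : Finset (Fin n), s.card = k ∧ s ≠ sstar ∧
    g = setMean ν sstar - setMean ν s} ε

/-- One round of play: the offered set and the reward vector drawn in that round. -/
abbrev Round (n : ℕ) : Type := Finset (Fin n) × (Fin n → Bool)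

/-- The variables `N_a`, `C_a`, `UCB_a` that the algorithm maintains for every arm. -/
structure UCBState (n : ℕ) where
  count : Fin n → ℕ
  cumReward : Fin n → ℝ
  ucb : Fin n → EReal

/-- Initialization: `N_a = 0`, `C_a = 0`, `UCB_a = ∞`. -/
def initState (n : ℕ) : UCBState n where
  count := fun _ => 0
  cumReward := fun _ => 0
  ucb := fun _ => ⊤

/-- The update of the algorithm (parameter `α`, horizon `T`) after a round: for the arms `a` of the
offered set, `N_a` increases by one, `C_a` increases by the observed reward, and `UCB_a` becomes
`C_a / N_a + √(α log T / N_a)`; the variables of the other arms do not change. -/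
def updateState {n : ℕ} (α : ℝ) (T : ℕ) (σ : UCBState n) (r : Round n) : UCBState n where
  count := fun a => if a ∈ r.1 then σ.count a + 1 else σ.count a
  cumReward := fun a => if a ∈ r.1 then σ.cumReward a + armReward r.2 a else σ.cumReward a
  ucb := fun a =>
    if a ∈ r.1 then
      (((σ.cumReward a + armReward r.2 a) / ((σ.count a : ℝ) + 1)
        + Real.sqrt (α * Real.log (T : ℝ) / ((σ.count a : ℝ) + 1)) : ℝ) : EReal)
    else σ.ucb a

/-- The variables of the algorithm after the `t` rounds `h 0, …, h (t - 1)`. -/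
def stateAfter {n : ℕ} (α : ℝ) (T : ℕ) : (t : ℕ) → (Fin t → Round n) → UCBState n
  | 0, _ => initState n
  | t + 1, h => updateState α T (stateAfter α T t (Fin.init h)) (h (Fin.last t))

/-- A (randomized, history-dependent) rule choosing the set offered in the next round. -/
abbrev SelectionRule (n : ℕ) : Type := (t : ℕ) → (Fin t → Round n) → PMF (Finset (Fin n))

/-- `s` consists of `k` arms with the `k` largest values of `u`. -/
def IsTopK {n : ℕ} (k : ℕ) (u : Fin n → EReal) (s : Finset (Fin n)) : Prop :=
  s.card = k ∧ ∀ a ∈ s, ∀ b, b ∉ s → u b ≤ u a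

/-- `π` is the top-`k` UCB algorithm with parameter `α` and horizon `T`, with some (possibly
random) way of breaking ties: every set that it may offer consists of arms with top-`k` UCB. -/
def IsTopKUCB {n : ℕ} (α : ℝ) (T k : ℕ) (π : SelectionRule n) : Prop :=
  ∀ (t : ℕ) (h : Fin t → Round n), ∀ s ∈ (π t h).support,
    IsTopK k (stateAfter α T t h).ucb s

/-- The law of the first `t` rounds when the sets are chosen by `π`: in every round, given the
past, a set `s` is drawn from the rule, and then, given the past and `s`, the rewards are drawn
from `ν s`. -/
def trajectoryLaw {n : ℕ} (ν : RewardModel n) (π : SelectionRule n) :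
    (t : ℕ) → PMF (Fin t → Round n)
  | 0 => PMF.pure (fun i => i.elim0)
  | t + 1 => (trajectoryLaw ν π t).bind fun h =>
      (π t h).bind fun s =>
        (ν s).map fun x => Fin.snoc (α := fun _ => Round n) h (s, x)

/-- The realized total reward of a round, the sum of the rewards of the offered arms. -/
def roundReward {n : ℕ} (r : Round n) : ℝ :=
  ∑ a ∈ r.1, armReward r.2 a

/-- `R(T) = ∑_{t = 1}^{T} E[Q(sstar) - Q(s(t))]`. -/
def regret {n : ℕ} (ν : RewardModel n) (π : SelectionRule n) (sstar : Finset (Fin n)) (T : ℕ) :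
    ℝ :=
  ∑ t : Fin T, (setMean ν sstar - expect (trajectoryLaw ν π T) (fun h => roundReward (h t)))

end

/-! Write L = α log T, θ_c = P(c | s*), and suppose that all confidence bounds hold. The index of an
arm left out in round t' is at most the index of any arm offered in a round t ≤ t'
(`ucb_le_ucb_of_isTopK`). By consistency an optimal arm d is never played with mean below θ_d, so
its index stays at least θ_d. Hence if d is missing in some round t' ≥ t, every arm offered in round
t has index at least θ_d, thus at least θ_c for every optimal c with θ_c ≤ θ_d. These c form the set
U_t of `unsettled` arms, which shrinks with t. The other optimal arms are all offered in round t, so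
the `contested` arms A_t are as many as U_t.

Fix a and c. The index bound in the last bad round with c ∈ U_t and a ∈ A_t controls the sum of θ_c
- P(a | S_t) over all such rounds by 3√(L m_a), where m_a counts the bad rounds in which a is
contested (`sum_deficit_le`). Plays of a inside s* could inflate its index, but `sum_le_three_sqrt`
removes their effect.

Settled arms do no worse in S_t than in s*, so |U_t| times the gap of round t is at most the sum of
θ_c - P(a | S_t) over U_t × A_t. Let Y be the sum of |U_t| · gap over bad rounds and Q = ∑ |U_t| = ∑
m_a. Then εQ ≤ Y ≤ 3k ∑ √(L m_a) ≤ 3k √(nLQ), which forces Y ≤ 9k²Ln/ε, and Y dominates the sum of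
the gaps (`sum_gap_le`).

The confidence bounds fail with probability at most 2nT²e^(-2L) (`expect_not_concentrated_le`), by
an exponential supermartingale and a union bound. This costs at most kn in regret. -/

/-! ### Counts, rewards and indices along a run -/

/-- The rounds before `t` in which arm `a` is offered. -/
def plays {n : ℕ} (H : ℕ → Round n) (a : Fin n) (t : ℕ) : Finset ℕ :=
  (Finset.range t).filter fun τ => a ∈ (H τ).1

theorem plays_succ {n : ℕ} (H : ℕ → Round n) (a : Fin n) (t : ℕ) :
    plays H a (t + 1) = if a ∈ (H t).1 then insert t (plays H a t) else plays H a t := by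
  simp only [plays, Finset.range_add_one, Finset.filter_insert]

theorem notMem_plays_self {n : ℕ} (H : ℕ → Round n) (a : Fin n) (t : ℕ) : t ∉ plays H a t := by
  simp [plays]

theorem mem_plays {n : ℕ} {H : ℕ → Round n} {a : Fin n} {t τ : ℕ} :
    τ ∈ plays H a t ↔ τ < t ∧ a ∈ (H τ).1 := by
  simp [plays]

theorem stateAfter_succ {n : ℕ} (α : ℝ) (T : ℕ) (H : ℕ → Round n) (t : ℕ) :
    stateAfter α T (t + 1) (fun i => H i) =
      updateState α T (stateAfter α T t (fun i => H i)) (H t) := rfl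

theorem count_stateAfter {n : ℕ} (α : ℝ) (T : ℕ) (H : ℕ → Round n) (t : ℕ) (a : Fin n) :
    (stateAfter α T t (fun i => H i)).count a = (plays H a t).card := by
  induction t with
  | zero => simp [stateAfter, initState, plays]
  | succ t ih =>
    rw [stateAfter_succ, plays_succ]
    by_cases h : a ∈ (H t).1
    · simp [updateState, h, ih, Finset.card_insert_of_notMem (notMem_plays_self H a t)]
    · simp [updateState, h, ih]

theorem cumReward_stateAfter {n : ℕ} (α : ℝ) (T : ℕ) (H : ℕ → Round n) (t : ℕ) (a : Fin n) :
    (stateAfter α T t (fun i => H i)).cumReward a =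
      ∑ τ ∈ plays H a t, armReward (H τ).2 a := by
  induction t with
  | zero => simp [stateAfter, initState, plays]
  | succ t ih =>
    rw [stateAfter_succ, plays_succ]
    by_cases h : a ∈ (H t).1
    · simp [updateState, h, ih, Finset.sum_insert (notMem_plays_self H a t), add_comm]
    · simp [updateState, h, ih]

theorem ucb_stateAfter {n : ℕ} (α : ℝ) (T : ℕ) (H : ℕ → Round n) (t : ℕ) (a : Fin n) :
    (stateAfter α T t (fun i => H i)).ucb a =
      if (plays H a t).card = 0 then ⊤ else
        (((∑ τ ∈ plays H a t, armReward (H τ).2 a) / ((plays H a t).card : ℝ)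
          + Real.sqrt (α * Real.log (T : ℝ) / ((plays H a t).card : ℝ)) : ℝ) : EReal) := by
  induction t with
  | zero => simp [stateAfter, initState, plays]
  | succ t ih =>
    rw [stateAfter_succ, plays_succ]
    by_cases h : a ∈ (H t).1
    · simp only [updateState, h, if_true, count_stateAfter, cumReward_stateAfter,
        Finset.card_insert_of_notMem (notMem_plays_self H a t),
        Finset.sum_insert (notMem_plays_self H a t)]
      simp [add_comm]
    · simp only [updateState, h, if_false, ih]

theorem ucb_succ_of_notMem {n : ℕ} (α : ℝ) (T : ℕ) (H : ℕ → Round n) (t : ℕ) (a : Fin n)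
    (h : a ∉ (H t).1) :
    (stateAfter α T (t + 1) (fun i => H i)).ucb a = (stateAfter α T t (fun i => H i)).ucb a := by
  rw [stateAfter_succ]
  simp [updateState, h]

/-- Clearing the denominator N_a makes the criterion uniform: for an unplayed arm the index is ⊤ and
the right side reads 0 ≤ 0. -/
theorem coe_le_ucb_iff {n : ℕ} (α : ℝ) (T : ℕ) (H : ℕ → Round n) (t : ℕ) (a : Fin n) (θ : ℝ) :
    (θ : EReal) ≤ (stateAfter α T t (fun i => H i)).ucb a ↔
      (plays H a t).card * θ ≤ ∑ τ ∈ plays H a t, armReward (H τ).2 a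
        + Real.sqrt (α * Real.log T * (plays H a t).card) := by
  rw [ucb_stateAfter]
  rcases Nat.eq_zero_or_pos (plays H a t).card with h0 | hpos
  · have : plays H a t = ∅ := Finset.card_eq_zero.mp h0
    simp [this]
  · have hN : (0 : ℝ) < (plays H a t).card := by exact_mod_cast hpos
    rw [if_neg hpos.ne', EReal.coe_le_coe_iff]
    set N : ℝ := ((plays H a t).card : ℝ)
    have hs : Real.sqrt (α * Real.log T * N) = Real.sqrt (α * Real.log T / N) * N := by
      have : α * Real.log T * N = α * Real.log T / N * N ^ 2 := by field_simp
      rw [this, Real.sqrt_mul' _ (sq_nonneg N), Real.sqrt_sq hN.le]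
    rw [hs, ← mul_le_mul_iff_of_pos_left hN]
    have : N * ((∑ τ ∈ plays H a t, armReward (H τ).2 a) / N
        + Real.sqrt (α * Real.log T / N)) =
        ∑ τ ∈ plays H a t, armReward (H τ).2 a + Real.sqrt (α * Real.log T / N) * N := by
      field_simp
    rw [this]

/-- Along a run of top-`k` UCB, the index of an arm that is not offered is at most the index that
any arm had in any earlier round in which it was offered. -/
theorem ucb_le_ucb_of_isTopK {n k T : ℕ} {α : ℝ} {H : ℕ → Round n}
    (htop : ∀ t < T, IsTopK k (stateAfter α T t (fun i => H i)).ucb (H t).1)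
    {t t' : ℕ} (htt : t ≤ t') (ht' : t' < T) {a c : Fin n} (ha : a ∈ (H t).1)
    (hc : c ∉ (H t').1) :
    (stateAfter α T t' (fun i => H i)).ucb c ≤ (stateAfter α T t (fun i => H i)).ucb a := by
  induction t', htt using Nat.le_induction generalizing c with
  | base => exact (htop t ht').2 a ha c hc
  | succ s hs ih =>
    by_contra! hlt
    -- An arm left out in round s keeps its index, which is at most that of `a` by induction. All k
    -- + 1 arms here exceed that value, so all were offered in round s, which has room for only k.
    have hsub : insert c (H (s + 1)).1 ⊆ (H s).1 := by
      intro b hb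
      by_contra hbs
      have h1 := ih (by omega) hbs
      rw [← ucb_succ_of_notMem α T H s b hbs] at h1
      have h2 : (stateAfter α T (s + 1) (fun i => H i)).ucb c ≤
          (stateAfter α T (s + 1) (fun i => H i)).ucb b := by
        rcases Finset.mem_insert.mp hb with rfl | hb
        · exact le_rfl
        · exact (htop (s + 1) ht').2 b hb c hc
      exact absurd (h2.trans h1) (not_le.mpr hlt)
    have h3 := Finset.card_le_card hsub
    rw [Finset.card_insert_of_notMem hc, (htop (s + 1) ht').1, (htop s (by omega)).1] at h3
    omega

/-! ### Expectations under finite laws -/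

section Expectation

variable {β γ : Type*} [Fintype β] [Fintype γ]

theorem sum_toReal_pmf (p : PMF β) : ∑ b, (p b).toReal = 1 := by
  rw [← ENNReal.toReal_sum fun b _ => p.apply_ne_top b, ← tsum_fintype (L := .unconditional β),
    p.tsum_coe, ENNReal.toReal_one]

theorem expect_const (p : PMF β) (c : ℝ) : expect p (fun _ => c) = c := by
  rw [expect, ← Finset.sum_mul, sum_toReal_pmf, one_mul]

theorem expect_mono_on_support {p : PMF β} {f g : β → ℝ} (h : ∀ b ∈ p.support, f b ≤ g b) :
    expect p f ≤ expect p g := by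
  refine Finset.sum_le_sum fun b _ => ?_
  by_cases hb : b ∈ p.support
  · exact mul_le_mul_of_nonneg_left (h b hb) ENNReal.toReal_nonneg
  · simp [(PMF.apply_eq_zero_iff p b).mpr hb]

theorem expect_mono {p : PMF β} {f g : β → ℝ} (h : ∀ b, f b ≤ g b) : expect p f ≤ expect p g :=
  expect_mono_on_support fun b _ => h b

theorem expect_add (p : PMF β) (f g : β → ℝ) :
    expect p (fun b => f b + g b) = expect p f + expect p g := by
  simp only [expect, mul_add, Finset.sum_add_distrib]

theorem expect_sub (p : PMF β) (f g : β → ℝ) :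
    expect p (fun b => f b - g b) = expect p f - expect p g := by
  simp only [expect, mul_sub, Finset.sum_sub_distrib]

theorem expect_const_mul (p : PMF β) (c : ℝ) (f : β → ℝ) :
    expect p (fun b => c * f b) = c * expect p f := by
  simp only [expect, Finset.mul_sum]
  exact Finset.sum_congr rfl fun b _ => by ring

theorem expect_sum {ι : Type*} (p : PMF β) (s : Finset ι) (f : ι → β → ℝ) :
    expect p (fun b => ∑ i ∈ s, f i b) = ∑ i ∈ s, expect p (f i) := by
  simp only [expect, Finset.mul_sum]
  exact Finset.sum_comm

theorem expect_pure (b : β) (f : β → ℝ) : expect (PMF.pure b) f = f b := by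
  classical
  rw [expect, Finset.sum_eq_single b]
  · simp
  · intro c _ hc
    simp [hc]
  · simp

theorem expect_bind (p : PMF β) (q : β → PMF γ) (f : γ → ℝ) :
    expect (p.bind q) f = expect p fun b => expect (q b) f := by
  simp only [expect, PMF.bind_apply, tsum_fintype, Finset.mul_sum]
  rw [Finset.sum_comm]
  refine Finset.sum_congr rfl fun c _ => ?_
  rw [ENNReal.toReal_sum fun b _ => ENNReal.mul_ne_top (p.apply_ne_top b) ((q b).apply_ne_top c),
    Finset.sum_mul]
  exact Finset.sum_congr rfl fun b _ => by rw [ENNReal.toReal_mul, mul_assoc]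

theorem expect_map (p : PMF β) (g : β → γ) (f : γ → ℝ) :
    expect (p.map g) f = expect p fun b => f (g b) := by
  rw [← PMF.bind_pure_comp, expect_bind]
  simp only [Function.comp, expect_pure]

end Expectation

/-! ### Means of arms and sets, and Hoeffding's lemma -/

theorem armReward_mem_Icc {n : ℕ} (x : Fin n → Bool) (a : Fin n) :
    armReward x a ∈ Set.Icc (0 : ℝ) 1 := by
  unfold armReward
  split_ifs <;> simp

theorem armMean_nonneg {n : ℕ} (ν : RewardModel n) (a : Fin n) (s : Finset (Fin n)) :
    0 ≤ armMean ν a s := by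
  rw [← expect_const (ν s) 0]
  exact expect_mono fun x => (armReward_mem_Icc x a).1

theorem armMean_le_one {n : ℕ} (ν : RewardModel n) (a : Fin n) (s : Finset (Fin n)) :
    armMean ν a s ≤ 1 := by
  rw [← expect_const (ν s) 1]
  exact expect_mono fun x => (armReward_mem_Icc x a).2

theorem setMean_eq_sum_armMean {n : ℕ} (ν : RewardModel n) (s : Finset (Fin n)) :
    setMean ν s = ∑ a ∈ s, armMean ν a s :=
  expect_sum (ν s) s fun a x => armReward x a

theorem setMean_nonneg {n : ℕ} (ν : RewardModel n) (s : Finset (Fin n)) : 0 ≤ setMean ν s := by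
  rw [setMean_eq_sum_armMean]
  exact Finset.sum_nonneg fun a _ => armMean_nonneg ν a s

theorem setMean_le_card {n : ℕ} (ν : RewardModel n) (s : Finset (Fin n)) :
    setMean ν s ≤ s.card := by
  rw [setMean_eq_sum_armMean]
  simpa using Finset.sum_le_card_nsmul s (fun a => armMean ν a s) 1
    fun a _ => armMean_le_one ν a s

/-- Hoeffding's lemma for the centered reward of one arm. -/
theorem expect_exp_centered_reward_le {n : ℕ} (ν : RewardModel n) (s : Finset (Fin n))
    (a : Fin n) (l : ℝ) :
    expect (ν s) (fun x => Real.exp (l * (armReward x a - armMean ν a s))) ≤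
      Real.exp (l ^ 2 / 8) := by
  have h := (ProbabilityTheory.hasSubgaussianMGF_of_mem_Icc (μ := (ν s).toMeasure)
    (X := fun x => armReward x a) (a := 0) (b := 1) (measurable_of_finite _).aemeasurable
    (Filter.Eventually.of_forall fun x => armReward_mem_Icc x a)).mgf_le l
  have hint : ∀ f : (Fin n → Bool) → ℝ, ∫ x, f x ∂(ν s).toMeasure = expect (ν s) f := fun f => by
    rw [PMF.integral_eq_sum]
    rfl
  rw [ProbabilityTheory.mgf, hint, hint] at h
  refine h.trans_eq ?_
  congr 1
  simp
  ring

/-! ### Deterministic regret bound from index inequalities -/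

/-- The optimal arms that are at most as good, in `sstar`, as some optimal arm that is still
missing from an offered set in round `t` or later. -/
noncomputable def unsettled {n : ℕ} (S : ℕ → Finset (Fin n)) (sstar : Finset (Fin n)) (θ : Fin n → ℝ)
    (T t : ℕ) :
    Finset (Fin n) :=
  open Classical in
  sstar.filter fun c => ∃ t', t ≤ t' ∧ t' < T ∧ ∃ d ∈ sstar \ S t', θ c ≤ θ d

/-- The arms offered in round `t`, without the optimal arms that are settled. -/
noncomputable def contested {n : ℕ} (S : ℕ → Finset (Fin n)) (sstar : Finset (Fin n)) (θ : Fin n → ℝ)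
    (T t : ℕ) :
    Finset (Fin n) :=
  S t \ (sstar \ unsettled S sstar θ T t)

/-- The rounds before `T` in which a set other than `sstar` is offered. -/
def badRounds {n : ℕ} (S : ℕ → Finset (Fin n)) (sstar : Finset (Fin n)) (T : ℕ) : Finset ℕ :=
  (Finset.range T).filter fun t => S t ≠ sstar

section Deterministic

variable {n : ℕ} {S : ℕ → Finset (Fin n)} {sstar : Finset (Fin n)} {θ : Fin n → ℝ} {T : ℕ}

theorem mem_unsettled {t : ℕ} {c : Fin n} :
    c ∈ unsettled S sstar θ T t ↔
      c ∈ sstar ∧ ∃ t', t ≤ t' ∧ t' < T ∧ ∃ d ∈ sstar \ S t', θ c ≤ θ d := by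
  simp [unsettled]

theorem unsettled_subset (t : ℕ) : unsettled S sstar θ T t ⊆ sstar :=
  fun _ hc => (mem_unsettled.mp hc).1

theorem unsettled_antitone {t t' : ℕ} (h : t ≤ t') :
    unsettled S sstar θ T t' ⊆ unsettled S sstar θ T t := by
  intro c hc
  rw [mem_unsettled] at hc ⊢
  obtain ⟨h1, u, h2, h3⟩ := hc
  exact ⟨h1, u, h.trans h2, h3⟩

theorem mem_contested {t : ℕ} {a : Fin n} :
    a ∈ contested S sstar θ T t ↔ a ∈ S t ∧ (a ∈ sstar → a ∈ unsettled S sstar θ T t) := by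
  simp [contested]

theorem settled_subset {t : ℕ} (ht : t < T) : sstar \ unsettled S sstar θ T t ⊆ S t := by
  intro c hc
  rw [Finset.mem_sdiff, mem_unsettled] at hc
  by_contra h
  exact hc.2 ⟨hc.1, t, le_rfl, ht, c, Finset.mem_sdiff.mpr ⟨hc.1, h⟩, le_rfl⟩

theorem card_contested {t : ℕ} (ht : t < T) (hcard : (S t).card = sstar.card) :
    (contested S sstar θ T t).card = (unsettled S sstar θ T t).card := by
  have h1 := Finset.card_sdiff_add_card_eq_card
    (settled_subset (θ := θ) (S := S) (sstar := sstar) ht)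
  have h2 := Finset.card_sdiff_add_card_eq_card (unsettled_subset (S := S) (sstar := sstar)
    (θ := θ) (T := T) t)
  rw [contested]
  omega

theorem unsettled_nonempty {t : ℕ} (ht : t < T) (hcard : (S t).card = sstar.card)
    (hne : S t ≠ sstar) : (unsettled S sstar θ T t).Nonempty := by
  by_contra h
  rw [Finset.not_nonempty_iff_eq_empty] at h
  have h1 := settled_subset (θ := θ) (S := S) (sstar := sstar) ht
  rw [h, Finset.sdiff_empty] at h1
  exact hne (Finset.eq_of_subset_of_card_le h1 hcard.le).symm

theorem two_sqrt_le_div_add_mul {L y z : ℝ} (hL : 0 ≤ L) (hy : 0 < y) (hz : 0 ≤ z) :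
    2 * Real.sqrt (L * z) ≤ L / y + y * z := by
  have h : L * z = (L / y) * (y * z) := by field_simp
  rw [h, Real.sqrt_mul (by positivity)]
  nlinarith [sq_nonneg (Real.sqrt (L / y) - Real.sqrt (y * z)), Real.sq_sqrt (div_nonneg hL hy.le),
    Real.sq_sqrt (mul_nonneg hy.le hz)]

/-- If a sum of `f ≥ 1` terms is small once `g` further terms, each equal to `Δ`, are added, then
it is small by itself. -/
theorem sum_le_three_sqrt {L f g Δ x : ℝ} (hL : 1 ≤ L) (hf : 1 ≤ f) (hg : 0 ≤ g)
    (h1 : x + g * Δ ≤ 1 + 2 * Real.sqrt (L * (f + g))) (h2 : 0 < g → x ≤ f * Δ) :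
    x ≤ 3 * Real.sqrt (L * f) := by
  have hLf : 1 ≤ Real.sqrt (L * f) := by
    rw [Real.one_le_sqrt]
    nlinarith
  -- This y = √(L/f) balances the two terms of the AM-GM bound at g = 0, so that 2√(L(f + g)) ≤
  -- 2√(Lf) + yg.
  set y := Real.sqrt (L * f) / f with hy
  have hypos : 0 < y := by positivity
  have hyf : y * f = Real.sqrt (L * f) := by rw [hy]; field_simp
  have hLy : L / y = Real.sqrt (L * f) := by
    rw [div_eq_iff hypos.ne', hy, mul_div_assoc', Real.mul_self_sqrt (by positivity)]
    field_simp
  have h3 := two_sqrt_le_div_add_mul (L := L) (y := y) (z := f + g) (by linarith) hypos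
    (by linarith)
  rw [hLy, mul_add y, hyf] at h3
  -- If Δ ≥ y, the excess yg is absorbed by gΔ. If Δ < y and g > 0, then x ≤ fΔ ≤ fy = √(Lf).
  rcases le_or_gt y Δ with h | h
  · nlinarith [mul_le_mul_of_nonneg_right h hg]
  · rcases hg.eq_or_lt with hg0 | hg0
    · rw [← hg0] at h1 h3
      linarith
    · have := h2 hg0
      nlinarith

/-- Since `unsettled` is antitone, every earlier bad play of `a` before the last round of the sum
also belongs to the sum. The confidence inequality of that one round therefore covers the whole sum,
up to the plays of `a` inside `sstar`. -/
theorem sum_deficit_le {P : Fin n → Finset (Fin n) → ℝ} {L : ℝ} (hL : 1 ≤ L)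
    (hP : ∀ a s, 0 ≤ P a s) (hθ : ∀ a, θ a ≤ 1) (hθs : ∀ a, P a sstar = θ a)
    (hθP : ∀ t < T, ∀ a ∈ S t, a ∈ sstar → θ a ≤ P a (S t))
    (hconf : ∀ t < T, ∀ a ∈ S t, ∀ c ∈ unsettled S sstar θ T t,
      (((Finset.range t).filter fun τ => a ∈ S τ).card : ℝ) * θ c ≤
        ∑ τ ∈ (Finset.range t).filter (fun τ => a ∈ S τ), P a (S τ)
          + 2 * Real.sqrt (L * ((Finset.range t).filter fun τ => a ∈ S τ).card))
    (a c : Fin n) :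
    ∑ t ∈ (badRounds S sstar T).filter
        (fun t => c ∈ unsettled S sstar θ T t ∧ a ∈ contested S sstar θ T t),
      (θ c - P a (S t)) ≤
    3 * Real.sqrt (L * ((badRounds S sstar T).filter
        fun t => a ∈ contested S sstar θ T t).card) := by
  set F := (badRounds S sstar T).filter
    (fun t => c ∈ unsettled S sstar θ T t ∧ a ∈ contested S sstar θ T t) with hF
  have hFm : ∀ t, t ∈ F ↔ (t < T ∧ S t ≠ sstar) ∧ c ∈ unsettled S sstar θ T t ∧
      a ∈ contested S sstar θ T t := fun t => by simp [hF, badRounds]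
  rcases F.eq_empty_or_nonempty with h0 | hne
  · rw [h0, Finset.sum_empty]
    positivity
  have hmono : F.card ≤ ((badRounds S sstar T).filter
      fun t => a ∈ contested S sstar θ T t).card :=
    Finset.card_le_card (Finset.monotone_filter_right _ fun _ _ h => h.2)
  refine le_trans ?_ (mul_le_mul_of_nonneg_left (Real.sqrt_le_sqrt
    (mul_le_mul_of_nonneg_left (Nat.cast_le.mpr hmono) (by linarith))) (by norm_num : (0:ℝ) ≤ 3))
  set t₀ := F.max' hne
  have ht₀ : t₀ ∈ F := F.max'_mem hne
  obtain ⟨⟨ht₀T, -⟩, hc₀, ha₀⟩ := (hFm t₀).mp ht₀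
  set G := (Finset.range t₀).filter (fun τ => S τ = sstar ∧ a ∈ S τ) with hG
  have hplays : (Finset.range t₀).filter (fun τ => a ∈ S τ) = F.erase t₀ ∪ G := by
    ext τ
    simp only [Finset.mem_filter, Finset.mem_range, Finset.mem_union, Finset.mem_erase, hFm, hG]
    constructor
    · rintro ⟨hτ, haτ⟩
      by_cases hs : S τ = sstar
      · exact Or.inr ⟨hτ, hs, haτ⟩
      · refine Or.inl ⟨hτ.ne, ⟨hτ.trans ht₀T, hs⟩, unsettled_antitone hτ.le hc₀, ?_⟩
        rw [mem_contested] at ha₀ ⊢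
        exact ⟨haτ, fun h => unsettled_antitone hτ.le (ha₀.2 h)⟩
    · rintro (⟨hne', hτ⟩ | ⟨hτ, -, haτ⟩)
      · exact ⟨lt_of_le_of_ne (F.le_max' τ ((hFm τ).mpr hτ)) hne', (mem_contested.mp hτ.2.2).1⟩
      · exact ⟨hτ, haτ⟩
  have hdisj : Disjoint (F.erase t₀) G := by
    rw [Finset.disjoint_left]
    intro τ h1 h2
    exact ((hFm τ).mp (Finset.mem_of_mem_erase h1)).1.2 (Finset.mem_filter.mp h2).2.1
  have hkey := hconf t₀ ht₀T a (mem_contested.mp ha₀).1 c hc₀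
  rw [hplays, Finset.sum_union hdisj, Finset.card_union_of_disjoint hdisj,
    Finset.card_erase_of_mem ht₀] at hkey
  have hf1 : 1 ≤ F.card := hne.card_pos
  have hGsum : ∑ τ ∈ G, P a (S τ) = G.card * θ a := by
    rw [Finset.sum_congr rfl fun τ hτ => by rw [(Finset.mem_filter.mp hτ).2.1, hθs],
      Finset.sum_const, nsmul_eq_mul]
  have hFsum : ∑ t ∈ F, (θ c - P a (S t)) =
      (θ c - P a (S t₀)) + (((F.card : ℝ) - 1) * θ c - ∑ t ∈ F.erase t₀, P a (S t)) := by
    rw [← Finset.add_sum_erase F _ ht₀, Finset.sum_sub_distrib, Finset.sum_const,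
      Finset.card_erase_of_mem ht₀, nsmul_eq_mul, Nat.cast_sub hf1, Nat.cast_one]
  rw [hGsum, Nat.cast_add, Nat.cast_sub hf1, Nat.cast_one] at hkey
  have hsq : Real.sqrt (L * ((F.card : ℝ) - 1 + G.card)) ≤ Real.sqrt (L * (F.card + G.card)) :=
    Real.sqrt_le_sqrt (mul_le_mul_of_nonneg_left (by linarith) (by linarith))
  refine sum_le_three_sqrt (g := G.card) (Δ := θ c - θ a) hL (by exact_mod_cast hf1)
    (Nat.cast_nonneg _) ?_ ?_
  -- The last round is not yet among the plays counted by `hkey`; its term is at most 1.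
  · rw [hFsum]
    linarith [hθ c, hP a (S t₀)]
  -- A play inside `sstar` means that `a` is optimal, so consistency bounds every term by θ c - θ a.
  · intro hg
    obtain ⟨τ, hτ⟩ := Finset.card_pos.mp (Nat.cast_pos.mp hg)
    obtain ⟨-, hτs, hτa⟩ := Finset.mem_filter.mp hτ
    rw [← nsmul_eq_mul]
    refine Finset.sum_le_card_nsmul _ _ _ fun t ht => ?_
    obtain ⟨⟨htT, -⟩, -, hat⟩ := (hFm t).mp ht
    linarith [hθP t htT a (mem_contested.mp hat).1 (hτs ▸ hτa)]

/-- Settled arms lie in both sets and do not lose in `S t`, so the gap comes from the unsettled and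
contested arms. These are equally many, and the sum over all pairs counts each arm that many times.
-/
theorem card_unsettled_mul_gap_le {P : Fin n → Finset (Fin n) → ℝ}
    (hθP : ∀ t < T, ∀ a ∈ S t, a ∈ sstar → θ a ≤ P a (S t)) {t : ℕ} (ht : t < T)
    (hcard : (S t).card = sstar.card) :
    ((unsettled S sstar θ T t).card : ℝ) * (∑ c ∈ sstar, θ c - ∑ a ∈ S t, P a (S t)) ≤
      ∑ c ∈ unsettled S sstar θ T t, ∑ a ∈ contested S sstar θ T t, (θ c - P a (S t)) := by
  have h1 : ∑ c ∈ unsettled S sstar θ T t, ∑ a ∈ contested S sstar θ T t, (θ c - P a (S t)) =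
      (unsettled S sstar θ T t).card *
        (∑ c ∈ unsettled S sstar θ T t, θ c - ∑ a ∈ contested S sstar θ T t, P a (S t)) := by
    simp only [Finset.sum_sub_distrib, Finset.sum_const, nsmul_eq_mul, card_contested ht hcard,
      ← Finset.mul_sum]
    ring
  rw [h1]
  refine mul_le_mul_of_nonneg_left ?_ (Nat.cast_nonneg _)
  have h2 := Finset.sum_sdiff (f := θ) (unsettled_subset (S := S) (sstar := sstar)
    (θ := θ) (T := T) t)
  have h3 := Finset.sum_sdiff (f := fun a => P a (S t))
    (settled_subset (θ := θ) (S := S) (sstar := sstar) ht)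
  have h4 : ∑ a ∈ sstar \ unsettled S sstar θ T t, θ a ≤
      ∑ a ∈ sstar \ unsettled S sstar θ T t, P a (S t) :=
    Finset.sum_le_sum fun a ha => hθP t ht a (settled_subset ht ha) (Finset.mem_sdiff.mp ha).1
  rw [contested]
  linarith

/-- Here Y² ≤ 9r²LNQ, while Q ≤ Y/ε; one factor Y cancels. -/
theorem le_div_of_self_bounding {L ε r N Y Q Z : ℝ} (hL : 0 ≤ L) (hε : 0 < ε) (hN : 0 ≤ N)
    (hQ : 0 ≤ Q) (hQY : ε * Q ≤ Y) (hY : Y ≤ r * (3 * Z)) (hZ : Z ^ 2 ≤ N * (L * Q)) :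
    Y ≤ 9 * r ^ 2 * L * N / ε := by
  have hY0 : 0 ≤ Y := (mul_nonneg hε.le hQ).trans hQY
  rw [le_div_iff₀ hε]
  rcases hY0.eq_or_lt with h0 | hpos
  · rw [← h0, zero_mul]
    positivity
  · refine le_of_mul_le_mul_left ?_ hpos
    have h3 : Y ^ 2 ≤ (r * (3 * Z)) ^ 2 := pow_le_pow_left₀ hY0 hY 2
    calc Y * (Y * ε) = ε * Y ^ 2 := by ring
      _ ≤ ε * (9 * r ^ 2 * (N * (L * Q))) := by
          refine mul_le_mul_of_nonneg_left (h3.trans ?_) hε.le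
          linarith [mul_le_mul_of_nonneg_left hZ (sq_nonneg r)]
      _ = 9 * r ^ 2 * L * N * (ε * Q) := by ring
      _ ≤ 9 * r ^ 2 * L * N * Y := mul_le_mul_of_nonneg_left hQY (by positivity)
      _ = _ := by ring

theorem sum_gap_le {P : Fin n → Finset (Fin n) → ℝ} {L ε : ℝ} (hL : 1 ≤ L) (hε : 0 < ε)
    (hP : ∀ a s, 0 ≤ P a s) (hθ : ∀ a, θ a ≤ 1) (hθs : ∀ a, P a sstar = θ a)
    (hθP : ∀ t < T, ∀ a ∈ S t, a ∈ sstar → θ a ≤ P a (S t))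
    (hcard : ∀ t < T, (S t).card = sstar.card)
    (hgap : ∀ t < T, S t ≠ sstar → ε ≤ ∑ c ∈ sstar, θ c - ∑ a ∈ S t, P a (S t))
    (hconf : ∀ t < T, ∀ a ∈ S t, ∀ c ∈ unsettled S sstar θ T t,
      (((Finset.range t).filter fun τ => a ∈ S τ).card : ℝ) * θ c ≤
        ∑ τ ∈ (Finset.range t).filter (fun τ => a ∈ S τ), P a (S τ)
          + 2 * Real.sqrt (L * ((Finset.range t).filter fun τ => a ∈ S τ).card)) :
    ∑ t ∈ Finset.range T, (∑ c ∈ sstar, θ c - ∑ a ∈ S t, P a (S t)) ≤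
      9 * (sstar.card : ℝ) ^ 2 * L * n / ε := by
  set gap : ℕ → ℝ := fun t => ∑ c ∈ sstar, θ c - ∑ a ∈ S t, P a (S t) with hgapdef
  set B := badRounds S sstar T with hB
  set q : ℕ → ℝ := fun t => ((unsettled S sstar θ T t).card : ℝ) with hq
  set m : Fin n → ℝ := fun a => ((B.filter fun t => a ∈ contested S sstar θ T t).card : ℝ) with hm
  have hBm : ∀ t ∈ B, t < T ∧ S t ≠ sstar := fun t ht => by simpa [hB, badRounds] using ht
  have hq1 : ∀ t ∈ B, 1 ≤ q t := fun t ht => by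
    have := (unsettled_nonempty (θ := θ) (hBm t ht).1 (hcard t (hBm t ht).1) (hBm t ht).2).card_pos
    exact Nat.one_le_cast.mpr this
  have hgapB : ∀ t ∈ B, ε ≤ gap t := fun t ht => hgap t (hBm t ht).1 (hBm t ht).2
  set Y := ∑ t ∈ B, q t * gap t with hY
  set Q := ∑ t ∈ B, q t with hQ
  have hRY : ∑ t ∈ Finset.range T, gap t ≤ Y := by
    -- Rounds that offer `sstar` have gap zero.
    have h1 : ∑ t ∈ Finset.range T, gap t = ∑ t ∈ B, gap t := by
      refine (Finset.sum_filter_of_ne (p := fun t => S t ≠ sstar) fun t _ hne hs => hne ?_).symm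
      simp only [hgapdef, hs, hθs, sub_self]
    rw [h1]
    refine Finset.sum_le_sum fun t ht => ?_
    nlinarith [hq1 t ht, hgapB t ht]
  have hQY : ε * Q ≤ Y := by
    rw [hQ, hY, Finset.mul_sum]
    refine Finset.sum_le_sum fun t ht => ?_
    nlinarith [hq1 t ht, hgapB t ht]
  have hQ0 : 0 ≤ Q := Finset.sum_nonneg fun t ht => zero_le_one.trans (hq1 t ht)
  have hmQ : ∑ a, m a = Q := by
    have h1 : ∀ t ∈ B, q t = ((contested S sstar θ T t).card : ℝ) := fun t ht => by
      rw [card_contested (hBm t ht).1 (hcard t (hBm t ht).1)]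
    rw [hQ, Finset.sum_congr rfl h1]
    simp only [hm, Finset.card_filter, Nat.cast_sum]
    rw [Finset.sum_comm]
    refine Finset.sum_congr rfl fun t _ => ?_
    rw [← Nat.cast_sum]
    simp
  have hYle : Y ≤ sstar.card * (3 * ∑ a, Real.sqrt (L * m a)) := by
    calc Y ≤ ∑ t ∈ B, ∑ c ∈ unsettled S sstar θ T t, ∑ a ∈ contested S sstar θ T t,
            (θ c - P a (S t)) :=
          Finset.sum_le_sum fun t ht =>
            card_unsettled_mul_gap_le hθP (hBm t ht).1 (hcard t (hBm t ht).1)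
      _ = ∑ t ∈ B, ∑ c ∈ sstar, ∑ a, (if c ∈ unsettled S sstar θ T t ∧
            a ∈ contested S sstar θ T t then θ c - P a (S t) else 0) := by
          refine Finset.sum_congr rfl fun t _ => ?_
          rw [← Finset.sum_subset (unsettled_subset (S := S) (sstar := sstar)
            (θ := θ) (T := T) t)]
          · refine Finset.sum_congr rfl fun c hc => ?_
            simp [hc, Finset.sum_ite_mem]
          · intro c _ hc
            simp [hc]
      _ = ∑ c ∈ sstar, ∑ a, ∑ t ∈ B.filter (fun t => c ∈ unsettled S sstar θ T t ∧
            a ∈ contested S sstar θ T t), (θ c - P a (S t)) := by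
          rw [Finset.sum_comm]
          refine Finset.sum_congr rfl fun c _ => ?_
          rw [Finset.sum_comm]
          simp only [Finset.sum_filter]
      _ ≤ ∑ c ∈ sstar, ∑ a, 3 * Real.sqrt (L * m a) :=
          Finset.sum_le_sum fun c _ => Finset.sum_le_sum fun a _ =>
            sum_deficit_le hL hP hθ hθs hθP hconf a c
      _ = _ := by rw [Finset.sum_const, nsmul_eq_mul, ← Finset.mul_sum]
  -- Cauchy-Schwarz over the n arms.
  have hCS : (∑ a, Real.sqrt (L * m a)) ^ 2 ≤ n * (L * Q) := by
    have h1 := sq_sum_le_card_mul_sum_sq (s := Finset.univ) (f := fun a => Real.sqrt (L * m a))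
    have h2 : ∀ a, Real.sqrt (L * m a) ^ 2 = L * m a := fun a =>
      Real.sq_sqrt (mul_nonneg (by linarith) (Nat.cast_nonneg _))
    rw [Finset.sum_congr rfl fun a _ => h2 a, ← Finset.mul_sum, hmQ, Finset.card_univ,
      Fintype.card_fin] at h1
    exact h1
  exact hRY.trans (le_div_of_self_bounding (zero_le_one.trans hL) hε (Nat.cast_nonneg _) hQ0 hQY
    hYle hCS)

end Deterministic

/-! ### Regret when all confidence bounds hold -/

/-- The deviation of the cumulative reward of `a` before round `t` from the sum of its means. -/
noncomputable def deviation {n : ℕ} (ν : RewardModel n) (H : ℕ → Round n) (a : Fin n) (t : ℕ) : ℝ :=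
  ∑ τ ∈ plays H a t, (armReward (H τ).2 a - armMean ν a (H τ).1)

/-- All confidence bounds of the first `T` rounds hold, with squared radius `L / N_a`. -/
def Concentrated {n : ℕ} (ν : RewardModel n) (L : ℝ) (T : ℕ) (H : ℕ → Round n) : Prop :=
  ∀ a, ∀ t < T, |deviation ν H a t| ≤ Real.sqrt (L * (plays H a t).card)

theorem sum_setMean_gap_le {n k T : ℕ} {α ε : ℝ} {ν : RewardModel n} {sstar : Finset (Fin n)}
    {H : ℕ → Round n} (hL : 1 ≤ α * Real.log T) (hopt : IsOptimalSet ν k sstar)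
    (hcons : WeakOptimalSetConsistency ν k sstar) (hgap : IsMinGap ν k sstar ε) (hε : 0 < ε)
    (htop : ∀ t < T, IsTopK k (stateAfter α T t (fun i => H i)).ucb (H t).1)
    (hconc : Concentrated ν (α * Real.log T) T H) :
    ∑ t ∈ Finset.range T, (setMean ν sstar - setMean ν (H t).1) ≤
      9 * (k : ℝ) ^ 2 * (α * Real.log T) * n / ε := by
  have hgap' : ∀ t < T, (H t).1 ≠ sstar → ε ≤ setMean ν sstar - setMean ν (H t).1 :=
    fun t ht hne => hgap.2 ⟨_, (htop t ht).1, hne, rfl⟩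
  have hθP : ∀ t < T, ∀ a ∈ (H t).1, a ∈ sstar → armMean ν a sstar ≤ armMean ν a (H t).1 := by
    intro t ht a ha has
    by_cases hs : (H t).1 = sstar
    · rw [hs]
    · exact hcons _ (htop t ht).1 (by linarith [hgap' t ht hs]) a (Finset.mem_inter.mpr ⟨ha, has⟩)
  have key := sum_gap_le (S := fun t => (H t).1) (sstar := sstar)
    (θ := fun a => armMean ν a sstar) (P := fun a s => armMean ν a s) (T := T) hL hε
    (fun a s => armMean_nonneg ν a s) (fun a => armMean_le_one ν a sstar) (fun _ => rfl) hθP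
    (fun t ht => (htop t ht).1.trans hopt.1.symm)
    (fun t ht hne => by simpa only [setMean_eq_sum_armMean] using hgap' t ht hne) ?_
  · simpa only [setMean_eq_sum_armMean, hopt.1] using key
  · intro t ht a ha c hc
    obtain ⟨-, t', htt', ht', d, hd, hcd⟩ := mem_unsettled.mp hc
    rw [Finset.mem_sdiff] at hd
    -- Optimism: by consistency each play of `d` has mean at least its mean in `sstar`, and the
    -- radius covers the deviation.
    have hd1 : ((armMean ν d sstar : ℝ) : EReal) ≤
        (stateAfter α T t' (fun i => H i)).ucb d := by
      rw [coe_le_ucb_iff]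
      have h1 := (abs_le.mp (hconc d t' ht')).1
      rw [deviation, Finset.sum_sub_distrib] at h1
      have h2 := Finset.card_nsmul_le_sum (plays H d t') (fun τ => armMean ν d (H τ).1)
        (armMean ν d sstar) fun τ hτ =>
          hθP τ ((mem_plays.mp hτ).1.trans ht') d (mem_plays.mp hτ).2 hd.1
      rw [nsmul_eq_mul] at h2
      linarith
    have h3 : ((armMean ν c sstar : ℝ) : EReal) ≤ (stateAfter α T t (fun i => H i)).ucb a :=
      (EReal.coe_le_coe_iff.mpr hcd).trans (hd1.trans (ucb_le_ucb_of_isTopK htop htt' ht' ha hd.2))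
    rw [coe_le_ucb_iff] at h3
    have h4 := (abs_le.mp (hconc a t ht)).2
    rw [deviation, Finset.sum_sub_distrib] at h4
    change ((plays H a t).card : ℝ) * armMean ν c sstar ≤
      ∑ τ ∈ plays H a t, armMean ν a (H τ).1
        + 2 * Real.sqrt (α * Real.log T * (plays H a t).card)
    linarith

/-! ### Random histories and the exponential supermartingale -/

/-- A finite history, continued by rounds in which nothing is offered. -/
def extendHistory {n T : ℕ} (h : Fin T → Round n) : ℕ → Round n :=
  fun i => if hi : i < T then h ⟨i, hi⟩ else (∅, fun _ => false)

theorem extendHistory_coe {n T : ℕ} (h : Fin T → Round n) (i : Fin T) :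
    extendHistory h i = h i := by
  simp [extendHistory]

theorem extendHistory_snoc_of_lt {n T : ℕ} (h : Fin T → Round n) (r : Round n) {i : ℕ}
    (hi : i < T) :
    extendHistory (Fin.snoc (α := fun _ => Round n) h r : Fin (T + 1) → Round n) i =
      extendHistory h i := by
  simp [extendHistory, hi, Nat.lt_succ_of_lt hi, Fin.snoc]

theorem extendHistory_snoc_self {n T : ℕ} (h : Fin T → Round n) (r : Round n) :
    extendHistory (Fin.snoc (α := fun _ => Round n) h r : Fin (T + 1) → Round n) T = r := by
  simp [extendHistory, Fin.snoc]

theorem lt_of_mem_plays_extendHistory {n T : ℕ} {h : Fin T → Round n} {a : Fin n} {t τ : ℕ}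
    (hτ : τ ∈ plays (extendHistory h) a t) : τ < T := by
  by_contra hT
  simpa [extendHistory, hT] using (mem_plays.mp hτ).2

theorem plays_extendHistory_snoc {n T : ℕ} (h : Fin T → Round n) (r : Round n) (a : Fin n)
    (t : ℕ) :
    plays (extendHistory (Fin.snoc (α := fun _ => Round n) h r : Fin (T + 1) → Round n)) a t =
      if T < t ∧ a ∈ r.1 then insert T (plays (extendHistory h) a t)
      else plays (extendHistory h) a t := by
  ext τ
  rcases lt_trichotomy τ T with hlt | rfl | hgt
  · have : τ ≠ T := hlt.ne
    split_ifs <;> simp [mem_plays, extendHistory_snoc_of_lt h r hlt, this]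
  · have h1 : τ ∉ plays (extendHistory h) a t := fun hm =>
      lt_irrefl _ (lt_of_mem_plays_extendHistory hm)
    rw [mem_plays, extendHistory_snoc_self]
    split_ifs with hc <;> simp [h1, hc]
  · have h1 : τ ∉ plays (extendHistory h) a t := fun hm =>
      hgt.not_gt (lt_of_mem_plays_extendHistory hm)
    have h2 : τ ∉ plays (extendHistory
        (Fin.snoc (α := fun _ => Round n) h r : Fin (T + 1) → Round n)) a t := fun hm => by
      have := lt_of_mem_plays_extendHistory hm
      omega
    have : τ ≠ T := hgt.ne'
    split_ifs <;> simp [h1, h2, this]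

theorem deviation_extendHistory_snoc {n T : ℕ} (ν : RewardModel n) (h : Fin T → Round n)
    (r : Round n) (a : Fin n) (t : ℕ) :
    deviation ν (extendHistory (Fin.snoc (α := fun _ => Round n) h r : Fin (T + 1) → Round n)) a t =
      deviation ν (extendHistory h) a t +
        if T < t ∧ a ∈ r.1 then armReward r.2 a - armMean ν a r.1 else 0 := by
  have h1 : ∑ τ ∈ plays (extendHistory h) a t,
      (armReward (extendHistory (Fin.snoc (α := fun _ => Round n) h r :
          Fin (T + 1) → Round n) τ).2 a
        - armMean ν a (extendHistory (Fin.snoc (α := fun _ => Round n) h r :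
          Fin (T + 1) → Round n) τ).1) = deviation ν (extendHistory h) a t :=
    Finset.sum_congr rfl fun τ hτ => by
      rw [extendHistory_snoc_of_lt h r (lt_of_mem_plays_extendHistory hτ)]
  have hT : T ∉ plays (extendHistory h) a t := fun hm =>
    lt_irrefl _ (lt_of_mem_plays_extendHistory hm)
  rw [deviation, plays_extendHistory_snoc]
  split_ifs with hc
  · rw [Finset.sum_insert hT, h1, extendHistory_snoc_self, add_comm]
  · rw [h1, add_zero]

theorem expect_trajectoryLaw_succ {n : ℕ} (ν : RewardModel n) (π : SelectionRule n) (T : ℕ)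
    (f : (Fin (T + 1) → Round n) → ℝ) :
    expect (trajectoryLaw ν π (T + 1)) f =
      expect (trajectoryLaw ν π T) fun h => expect (π T h) fun s => expect (ν s) fun x =>
        f (Fin.snoc (α := fun _ => Round n) h (s, x)) := by
  simp only [trajectoryLaw, expect_bind, expect_map]

/-- The weight is a supermartingale in T: a play of `a` before round `t` multiplies it by a factor
of conditional mean at most 1, by Hoeffding's lemma, and any other round leaves it unchanged. -/
theorem expect_exp_deviation_le_one {n : ℕ} (ν : RewardModel n) (π : SelectionRule n) (a : Fin n)
    (l : ℝ) (t T : ℕ) :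
    expect (trajectoryLaw ν π T) (fun h => Real.exp (l * deviation ν (extendHistory h) a t
      - l ^ 2 / 8 * (plays (extendHistory h) a t).card)) ≤ 1 := by
  induction T with
  | zero =>
    have h0 : ∀ h : Fin 0 → Round n, plays (extendHistory h) a t = ∅ := fun h =>
      Finset.eq_empty_of_forall_notMem fun τ hτ =>
        absurd (lt_of_mem_plays_extendHistory hτ) (Nat.not_lt_zero τ)
    simp [trajectoryLaw, expect_pure, deviation, h0]
  | succ T ih =>
    rw [expect_trajectoryLaw_succ]
    refine le_trans (expect_mono fun h => ?_) ih
    rw [← expect_const (π T h) (Real.exp _)]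
    refine expect_mono fun s => ?_
    simp only [deviation_extendHistory_snoc, plays_extendHistory_snoc]
    have hT : T ∉ plays (extendHistory h) a t := fun hm =>
      lt_irrefl _ (lt_of_mem_plays_extendHistory hm)
    by_cases hc : T < t ∧ a ∈ s
    · simp only [hc, and_self, if_true, Finset.card_insert_of_notMem hT]
      have h1 : ∀ x : Fin n → Bool,
          Real.exp (l * (deviation ν (extendHistory h) a t + (armReward x a - armMean ν a s))
            - l ^ 2 / 8 * ((plays (extendHistory h) a t).card + 1 : ℕ)) =
          Real.exp (l * deviation ν (extendHistory h) a t
            - l ^ 2 / 8 * (plays (extendHistory h) a t).card) * Real.exp (-(l ^ 2 / 8)) *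
            Real.exp (l * (armReward x a - armMean ν a s)) := fun x => by
        rw [← Real.exp_add, ← Real.exp_add]
        congr 1
        push_cast
        ring
      simp only [h1, expect_const_mul]
      rw [mul_assoc]
      refine mul_le_of_le_one_right (Real.exp_nonneg _) ?_
      calc Real.exp (-(l ^ 2 / 8)) *
            expect (ν s) (fun x => Real.exp (l * (armReward x a - armMean ν a s)))
          ≤ Real.exp (-(l ^ 2 / 8)) * Real.exp (l ^ 2 / 8) :=
            mul_le_mul_of_nonneg_left (expect_exp_centered_reward_le ν s a l) (Real.exp_nonneg _)
        _ = 1 := by rw [← Real.exp_add, neg_add_cancel, Real.exp_zero]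
    · simp only [hc, if_false, add_zero, expect_const, le_refl]

theorem isTopK_of_mem_support_trajectoryLaw {n k T₀ : ℕ} {α : ℝ} {ν : RewardModel n}
    {π : SelectionRule n} (hπ : IsTopKUCB α T₀ k π) {T : ℕ} {h : Fin T → Round n}
    (hh : h ∈ (trajectoryLaw ν π T).support) {t : ℕ} (ht : t < T) :
    IsTopK k (stateAfter α T₀ t (fun i => extendHistory h i)).ucb (extendHistory h t).1 := by
  induction T generalizing t with
  | zero => exact absurd ht (Nat.not_lt_zero t)
  | succ T ih =>
    simp only [trajectoryLaw, PMF.mem_support_bind_iff, PMF.mem_support_map_iff] at hh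
    obtain ⟨h', hh', s, hs, x, -, rfl⟩ := hh
    have hpre : (fun i : Fin t => extendHistory
        (Fin.snoc (α := fun _ => Round n) h' (s, x) : Fin (T + 1) → Round n) i) =
        fun i : Fin t => extendHistory h' i :=
      funext fun i => extendHistory_snoc_of_lt h' _ (by omega)
    rw [hpre]
    rcases (Nat.lt_succ_iff.mp ht).lt_or_eq with hlt | rfl
    · rw [extendHistory_snoc_of_lt h' _ hlt]
      exact ih hh' hlt
    · rw [extendHistory_snoc_self, funext (extendHistory_coe h')]
      exact hπ t h' s hs

/-! ### Regret as an expected sum of gaps -/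

/-- The terms are martingale differences: given the past and the offered set, the reward has mean
`setMean`. -/
theorem expect_sum_setMean_sub_roundReward {n : ℕ} (ν : RewardModel n) (π : SelectionRule n)
    (T : ℕ) :
    expect (trajectoryLaw ν π T)
      (fun h => ∑ t : Fin T, (setMean ν (h t).1 - roundReward (h t))) = 0 := by
  induction T with
  | zero => simp [expect_const]
  | succ T ih =>
    rw [expect_trajectoryLaw_succ, ← ih]
    congr 1
    funext h
    have h1 : ∀ s : Finset (Fin n), expect (ν s) (fun x => roundReward (s, x)) = setMean ν s :=
      fun _ => rfl
    simp only [Fin.sum_univ_castSucc, Fin.snoc_castSucc, Fin.snoc_last, expect_add, expect_sub,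
      expect_const, h1, sub_self, add_zero]

theorem regret_eq_expect {n : ℕ} (ν : RewardModel n) (π : SelectionRule n)
    (sstar : Finset (Fin n)) (T : ℕ) :
    regret ν π sstar T = expect (trajectoryLaw ν π T) fun h =>
      ∑ t ∈ Finset.range T, (setMean ν sstar - setMean ν (extendHistory h t).1) := by
  have h1 : regret ν π sstar T = expect (trajectoryLaw ν π T)
      fun h => ∑ t : Fin T, (setMean ν sstar - roundReward (h t)) := by
    simp only [regret, expect_sum, expect_sub, expect_const]
  have h2 : ∀ h : Fin T → Round n, ∑ t : Fin T, (setMean ν sstar - roundReward (h t)) =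
      ∑ t ∈ Finset.range T, (setMean ν sstar - setMean ν (extendHistory h t).1) +
        ∑ t : Fin T, (setMean ν (h t).1 - roundReward (h t)) := fun h => by
    rw [Finset.sum_range, ← Finset.sum_add_distrib]
    refine Finset.sum_congr rfl fun t _ => ?_
    rw [extendHistory_coe]
    ring
  simp only [h1, h2, expect_add, expect_sum_setMean_sub_roundReward, add_zero]

/-! ### Probability that a confidence bound fails -/

/-- A deviation beyond the confidence radius makes one of the two exponential weights large. -/
theorem one_le_exp_add_exp_of_sqrt_lt_abs {L D : ℝ} {m : ℕ} (hL : 0 ≤ L) (hm : 0 < m)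
    (h : Real.sqrt (L * m) < |D|) :
    1 ≤ Real.exp (4 * Real.sqrt (L / m) * D - (4 * Real.sqrt (L / m)) ^ 2 / 8 * m - 2 * L) +
      Real.exp (-(4 * Real.sqrt (L / m)) * D - (-(4 * Real.sqrt (L / m))) ^ 2 / 8 * m - 2 * L) := by
  have hm' : (0 : ℝ) < m := Nat.cast_pos.mpr hm
  have h1 : Real.sqrt (L / m) * Real.sqrt (L * m) = L := by
    rw [← Real.sqrt_mul (by positivity), show L / m * (L * m) = L ^ 2 by field_simp,
      Real.sqrt_sq hL]
  have h2 : Real.sqrt (L / m) ^ 2 * m = L := by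
    rw [Real.sq_sqrt (by positivity)]
    field_simp
  have h3 : L ≤ Real.sqrt (L / m) * |D| := by
    calc L = Real.sqrt (L / m) * Real.sqrt (L * m) := h1.symm
      _ ≤ _ := mul_le_mul_of_nonneg_left h.le (Real.sqrt_nonneg _)
  rcases abs_cases D with ⟨hD, -⟩ | ⟨hD, -⟩ <;> rw [hD] at h3
  · have := Real.one_le_exp (x := 4 * Real.sqrt (L / m) * D
      - (4 * Real.sqrt (L / m)) ^ 2 / 8 * m - 2 * L) (by linarith)
    linarith [Real.exp_nonneg (-(4 * Real.sqrt (L / m)) * D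
      - (-(4 * Real.sqrt (L / m))) ^ 2 / 8 * m - 2 * L)]
  · have := Real.one_le_exp (x := -(4 * Real.sqrt (L / m)) * D
      - (-(4 * Real.sqrt (L / m))) ^ 2 / 8 * m - 2 * L) (by linarith)
    linarith [Real.exp_nonneg (4 * Real.sqrt (L / m) * D
      - (4 * Real.sqrt (L / m)) ^ 2 / 8 * m - 2 * L)]

-- The best exponent depends on the number of plays, which is random. The union bound therefore runs
-- over its possible values m < T, besides arms, rounds and the two signs.
open Classical in
theorem expect_not_concentrated_le {n : ℕ} (ν : RewardModel n) (π : SelectionRule n) {L : ℝ}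
    (hL : 0 ≤ L) (T : ℕ) :
    expect (trajectoryLaw ν π T)
      (fun h => if Concentrated ν L T (extendHistory h) then 0 else 1) ≤
      2 * n * (T : ℝ) ^ 2 * Real.exp (-(2 * L)) := by
  set W : ℝ → Fin n → ℕ → (Fin T → Round n) → ℝ := fun l a t h =>
    Real.exp (l * deviation ν (extendHistory h) a t
      - l ^ 2 / 8 * (plays (extendHistory h) a t).card - 2 * L) with hW
  have hW0 : ∀ l a t h, 0 ≤ W l a t h := fun _ _ _ _ => Real.exp_nonneg _
  have hWle : ∀ l a t, expect (trajectoryLaw ν π T) (W l a t) ≤ Real.exp (-(2 * L)) := by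
    intro l a t
    have h1 : W l a t = fun h => Real.exp (-(2 * L)) *
        Real.exp (l * deviation ν (extendHistory h) a t
          - l ^ 2 / 8 * (plays (extendHistory h) a t).card) := funext fun h => by
      simp only [hW]
      rw [← Real.exp_add]
      congr 1
      ring
    rw [h1, expect_const_mul]
    exact mul_le_of_le_one_right (Real.exp_nonneg _) (expect_exp_deviation_le_one ν π a l t T)
  -- The Chernoff optimum for m plays: with |D| > √(Lm), the exponent l|D| - l²m/8 is at least 4L -
  -- 2L = 2L.
  set l : ℕ → ℝ := fun m => 4 * Real.sqrt (L / m)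
  have hpt : ∀ h : Fin T → Round n,
      (if Concentrated ν L T (extendHistory h) then (0 : ℝ) else 1) ≤
        ∑ a, ∑ t ∈ Finset.range T, ∑ m ∈ Finset.range T, (W (l m) a t h + W (-l m) a t h) := by
    intro h
    have hnn : ∀ a t m, 0 ≤ W (l m) a t h + W (-l m) a t h := fun a t m =>
      add_nonneg (hW0 _ _ _ _) (hW0 _ _ _ _)
    split_ifs with hc
    · exact Finset.sum_nonneg fun a _ => Finset.sum_nonneg fun t _ => Finset.sum_nonneg
        fun m _ => hnn a t m
    · simp only [Concentrated, not_forall, not_le] at hc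
      obtain ⟨a, t, ht, hdev⟩ := hc
      set N := (plays (extendHistory h) a t).card with hN
      have hNt : N ≤ t := (Finset.card_filter_le _ _).trans_eq (Finset.card_range t)
      -- An arm never played has deviation 0 and violates nothing.
      have hN0 : 0 < N := by
        rw [hN, Finset.card_pos, Finset.nonempty_iff_ne_empty]
        intro h0
        simp [deviation, hN, h0] at hdev
      calc (1 : ℝ) ≤ W (l N) a t h + W (-l N) a t h :=
            one_le_exp_add_exp_of_sqrt_lt_abs hL hN0 hdev
        _ ≤ ∑ m ∈ Finset.range T, (W (l m) a t h + W (-l m) a t h) :=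
            Finset.single_le_sum (f := fun m => W (l m) a t h + W (-l m) a t h)
              (fun m _ => hnn a t m) (Finset.mem_range.mpr (hNt.trans_lt ht))
        _ ≤ ∑ t ∈ Finset.range T, ∑ m ∈ Finset.range T, (W (l m) a t h + W (-l m) a t h) :=
            Finset.single_le_sum
              (f := fun t => ∑ m ∈ Finset.range T, (W (l m) a t h + W (-l m) a t h))
              (fun t _ => Finset.sum_nonneg fun m _ => hnn a t m) (Finset.mem_range.mpr ht)
        _ ≤ _ := Finset.single_le_sum
              (f := fun a => ∑ t ∈ Finset.range T, ∑ m ∈ Finset.range T,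
                (W (l m) a t h + W (-l m) a t h))
              (fun a _ => Finset.sum_nonneg fun t _ => Finset.sum_nonneg fun m _ => hnn a t m)
              (Finset.mem_univ a)
  refine (expect_mono hpt).trans ?_
  simp only [expect_sum, expect_add]
  calc ∑ a, ∑ t ∈ Finset.range T, ∑ m ∈ Finset.range T,
        (expect (trajectoryLaw ν π T) (W (l m) a t) + expect (trajectoryLaw ν π T) (W (-l m) a t))
      ≤ ∑ _a : Fin n, ∑ _t ∈ Finset.range T, ∑ _m ∈ Finset.range T,
        (Real.exp (-(2 * L)) + Real.exp (-(2 * L))) :=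
        Finset.sum_le_sum fun a _ => Finset.sum_le_sum fun t _ => Finset.sum_le_sum fun m _ =>
          add_le_add (hWle _ _ _) (hWle _ _ _)
    _ = _ := by
        simp only [Finset.sum_const, Finset.card_range, Finset.card_univ, Fintype.card_fin,
          nsmul_eq_mul]
        ring

/-! ### Assembling the bound -/

theorem one_le_mul_log {α : ℝ} {T : ℕ} (hα : 2 ≤ α) (hT : 2 ≤ T) : 1 ≤ α * Real.log T := by
  have h1 : Real.log 2 ≤ Real.log T :=
    Real.log_le_log (by norm_num) (by exact_mod_cast hT)
  nlinarith [Real.log_two_gt_d9]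

theorem regret_le_of_two_le {n k T : ℕ} {α ε : ℝ} {ν : RewardModel n} {sstar : Finset (Fin n)}
    {π : SelectionRule n} (hα : 2 ≤ α) (hT : 2 ≤ T) (hopt : IsOptimalSet ν k sstar)
    (hcons : WeakOptimalSetConsistency ν k sstar) (hgap : IsMinGap ν k sstar ε) (hε : 0 < ε)
    (hπ : IsTopKUCB α T k π) :
    regret ν π sstar T ≤ 9 * (k : ℝ) ^ 2 * (α * Real.log T) * n / ε + k * n := by
  classical
  set L := α * Real.log T with hLdef
  have hL : 1 ≤ L := one_le_mul_log hα hT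
  have hT' : (2 : ℝ) ≤ T := by exact_mod_cast hT
  set W := 9 * (k : ℝ) ^ 2 * L * n / ε with hW
  have hW0 : 0 ≤ W := by positivity
  have hk : setMean ν sstar ≤ k := hopt.1 ▸ setMean_le_card ν sstar
  have hpt : ∀ h ∈ (trajectoryLaw ν π T).support,
      ∑ t ∈ Finset.range T, (setMean ν sstar - setMean ν (extendHistory h t).1) ≤
        W + T * k * (if Concentrated ν L T (extendHistory h) then 0 else 1) := by
    intro h hh
    split_ifs with hc
    · rw [mul_zero, add_zero]
      exact sum_setMean_gap_le hL hopt hcons hgap hε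
        (fun t ht => isTopK_of_mem_support_trajectoryLaw hπ hh ht) hc
    · have := Finset.sum_le_card_nsmul (Finset.range T)
        (fun t => setMean ν sstar - setMean ν (extendHistory h t).1) k fun t _ => by
          linarith [setMean_nonneg ν (extendHistory h t).1]
      rw [Finset.card_range, nsmul_eq_mul] at this
      linarith
  -- Here α ≥ 2 enters: 2L ≥ 4 log T. The failure event then costs at most Tk · 2nT²/T⁴ = 2kn/T.
  have hexp : Real.exp (-(2 * L)) ≤ ((T : ℝ) ^ 4)⁻¹ := by
    rw [Real.exp_neg]
    refine inv_anti₀ (by positivity) ?_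
    rw [← Real.exp_log (show (0 : ℝ) < (T : ℝ) ^ 4 by positivity), Real.log_pow]
    refine Real.exp_le_exp.mpr ?_
    push_cast
    nlinarith [Real.log_nonneg (show (1 : ℝ) ≤ T by linarith)]
  rw [regret_eq_expect]
  refine (expect_mono_on_support hpt).trans ?_
  rw [expect_add, expect_const, expect_const_mul]
  refine add_le_add le_rfl ?_
  calc T * k * expect (trajectoryLaw ν π T)
        (fun h => if Concentrated ν L T (extendHistory h) then 0 else 1)
      ≤ T * k * (2 * n * (T : ℝ) ^ 2 * ((T : ℝ) ^ 4)⁻¹) :=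
        mul_le_mul_of_nonneg_left ((expect_not_concentrated_le ν π (by linarith) T).trans
          (mul_le_mul_of_nonneg_left hexp (by positivity))) (by positivity)
    _ = k * n * (2 / T) := by field_simp
    _ ≤ k * n := mul_le_of_le_one_right (by positivity) ((div_le_one (by linarith)).mpr hT')

theorem regret_le_card_of_le_one {n T : ℕ} (ν : RewardModel n) (sstar : Finset (Fin n))
    (π : SelectionRule n) (hT : T ≤ 1) :
    regret ν π sstar T ≤ n := by
  have hk : setMean ν sstar ≤ n := (setMean_le_card ν sstar).trans
    (Nat.cast_le.mpr ((Finset.card_le_univ sstar).trans_eq (Fintype.card_fin n)))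
  rw [regret_eq_expect, ← expect_const (trajectoryLaw ν π T) (n : ℝ)]
  refine expect_mono fun h => ?_
  have h1 := Finset.sum_le_card_nsmul (Finset.range T)
    (fun t => setMean ν sstar - setMean ν (extendHistory h t).1) n fun t _ => by
      linarith [setMean_nonneg ν (extendHistory h t).1]
  rw [Finset.card_range, nsmul_eq_mul] at h1
  exact h1.trans (mul_le_of_le_one_left (Nat.cast_nonneg _) (by exact_mod_cast hT))

theorem isMinGap_le {n k : ℕ} {ε : ℝ} {ν : RewardModel n} {sstar : Finset (Fin n)}
    (hopt : IsOptimalSet ν k sstar) (hgap : IsMinGap ν k sstar ε) : ε ≤ k := by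
  obtain ⟨s, -, -, hs⟩ := hgap.1
  have h1 : setMean ν sstar ≤ k := hopt.1 ▸ setMean_le_card ν sstar
  linarith [setMean_nonneg ν s]

theorem mainTheorem1 :
    ∃ K : ℝ, 0 < K ∧
      ∀ (n k T : ℕ) (α ε : ℝ) (ν : RewardModel n) (sstar : Finset (Fin n)) (π : SelectionRule n),
        2 ≤ α →
        IsOptimalSet ν k sstar →
        WeakOptimalSetConsistency ν k sstar →
        IsMinGap ν k sstar ε →
        0 < ε →
        IsTopKUCB α T k π →
        regret ν π sstar T ≤
            8 * α * (k : ℝ) ^ (3 / 2 : ℝ) * n * Real.log T / ε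
              + 30 * α * (k : ℝ) ^ 2 * n * Real.log T / ε + n ∧
          (2 ≤ T →
            8 * α * (k : ℝ) ^ (3 / 2 : ℝ) * n * Real.log T / ε
              + 30 * α * (k : ℝ) ^ 2 * n * Real.log T / ε + n ≤
            K * (α * (k : ℝ) ^ 2 * n * Real.log T / ε)) := by
  -- 39 = 8 + 30 + 1: each of k^(3/2) and k² contributes its coefficient, and n ≤ kn ≤ V.
  refine ⟨39, by norm_num, fun n k T α ε ν sstar π hα hopt hcons hgap hε hπ => ?_⟩
  have hkε : ε ≤ k := isMinGap_le hopt hgap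
  have hk1 : (1 : ℝ) ≤ k := by
    have : 0 < k := Nat.cast_pos.mp (hε.trans_le hkε)
    exact_mod_cast this
  have hlog : 0 ≤ Real.log T := Real.log_natCast_nonneg T
  set V := α * (k : ℝ) ^ 2 * n * Real.log T / ε with hV
  have hV0 : 0 ≤ V := by positivity
  have e1 : 8 * α * (k : ℝ) ^ (3 / 2 : ℝ) * n * Real.log T / ε =
      8 * (α * (k : ℝ) ^ (3 / 2 : ℝ) * n * Real.log T / ε) := by ring
  have e2 : 30 * α * (k : ℝ) ^ 2 * n * Real.log T / ε = 30 * V := by rw [hV]; ring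
  have h32 : 0 ≤ α * (k : ℝ) ^ (3 / 2 : ℝ) * n * Real.log T / ε := by positivity
  have h32le : α * (k : ℝ) ^ (3 / 2 : ℝ) * n * Real.log T / ε ≤ V := by
    have : (k : ℝ) ^ (3 / 2 : ℝ) ≤ (k : ℝ) ^ 2 := by
      rw [← Real.rpow_natCast]
      exact Real.rpow_le_rpow_of_exponent_le hk1 (by norm_num)
    rw [hV]
    gcongr
  -- Uses ε ≤ k and α log T ≥ 1.
  have hkn : 2 ≤ T → (k : ℝ) * n ≤ V := fun hT => by
    rw [hV, le_div_iff₀ hε]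
    calc (k : ℝ) * n * ε ≤ k * n * k := by gcongr
      _ = (k : ℝ) ^ 2 * n * 1 := by ring
      _ ≤ (k : ℝ) ^ 2 * n * (α * Real.log T) :=
        mul_le_mul_of_nonneg_left (one_le_mul_log hα hT) (by positivity)
      _ = _ := by ring
  rw [e1, e2]
  refine ⟨?_, fun hT => ?_⟩
  -- For T ≥ 2 the regret is at most 9V + kn ≤ 10V, well within 30V. For T ≤ 1 the logarithm gives
  -- nothing, and the summand n covers the at most one round.
  · rcases le_or_gt 2 T with hT | hT
    · have h1 := regret_le_of_two_le hα hT hopt hcons hgap hε hπ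
      have h2 : 9 * (k : ℝ) ^ 2 * (α * Real.log T) * n / ε = 9 * V := by rw [hV]; ring
      linarith [hkn hT, Nat.cast_nonneg (α := ℝ) n]
    · linarith [regret_le_card_of_le_one ν sstar π (Nat.lt_succ_iff.mp hT)]
  · have := hkn hT
    nlinarith [Nat.cast_nonneg (α := ℝ) n]
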